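/- All graphs are finite, simple and undirected. The Laplacian matrix of a graph $G$ is $L(G)=D(G)-A(G)$, where $D(G)$ is the diagonal matrix of vertex degrees and $A(G)$ is the adjacency matrix; the Laplacian spectrum of $G$ is the multiset of eigenvalues of $L(G)$. Two graphs are $L$-cospectral if they have the same Laplacian spectrum, and $G$ is $L$-DS if every graph that is $L$-cospectral with $G$ is isomorphic to $G$. A graph is unicyclic if it is connected and contains exactly one cycle. $G+H$ denotes the disjoint union of $G$ and $H$, $mG$ is the disjoint union of $m$ copies of $G$, and $G\times H$ denotes $G+H$ together with all edges joining a vertex of $G$ to a vertex of $H$. $K_m$, $P_m$, $C_m$ are the complete graph, the path and the cycle on $m$ vertices. **Theorem.** If a unicyclic graph $U$ is $L$-DS and is not isomorphic to $C_6$, then $U\times K_m$ is $L$-DS for every integer $m\ge 1$. Moreover, $C_6\times K_1$ is $L$-cospectral with, but not isomorphic to, $2K_1\times(2P_2+K_1)$. -/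

import Mathlib

namespace LapDS

/-- The product (join) `G × H` of two graphs: their disjoint union together with all the edges
joining a vertex of `G` to a vertex of `H`. -/
def join {V W : Type*} (G : SimpleGraph V) (H : SimpleGraph W) : SimpleGraph (V ⊕ W) :=
  SimpleGraph.sum G H ⊔ completeBipartiteGraph V W

open Classical in
/-- The Laplacian spectrum of a finite graph: the multiset of the eigenvalues of the Laplacian
matrix `D - A`, with multiplicity. The matrix is real symmetric, so its characteristic polynomial
splits over `ℝ` and its roots are all the eigenvalues. -/
noncomputable def lapSpec {V : Type*} [Fintype V] (G : SimpleGraph V) : Multiset ℝ :=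
  (G.lapMatrix ℝ).charpoly.roots

/-- Two finite graphs are `L`-cospectral if they share the same Laplacian spectrum. -/
def LCospectral {V W : Type*} [Fintype V] [Fintype W]
    (G : SimpleGraph V) (H : SimpleGraph W) : Prop :=
  lapSpec G = lapSpec H

/-- A finite graph `G` is `L`-DS (determined by its Laplacian spectrum) if every finite graph that
is `L`-cospectral with `G` is isomorphic to `G`. -/
def IsLDS.{u} {V : Type u} [Fintype V] (G : SimpleGraph V) : Prop :=
  ∀ (W : Type u) [Fintype W] (H : SimpleGraph W), LCospectral H G → Nonempty (H ≃g G)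

/-- A graph is unicyclic if it is connected and contains exactly one cycle (cycles being counted as
subgraphs). -/
def IsUnicyclic {V : Type*} (G : SimpleGraph V) : Prop :=
  G.Connected ∧ ∃! S : G.Subgraph, ∃ (v : V) (c : G.Walk v v), c.IsCycle ∧ c.toSubgraph = S

/-- The complete graph `K_m` on `m` vertices. -/
def K (m : ℕ) : SimpleGraph (Fin m) := ⊤

end LapDS

namespace LapDS

open Matrix Polynomial

/-! The argument lives in the complement. The complement of U × K_m is Uᶜ with m isolated vertices
added, and complementation preserves cospectrality (`lapSpec_compl`), so it suffices that every Q
cospectral with Uᶜ + mK_1 is isomorphic to it. Induction on m strips isolated vertices from Q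
(`nonempty_iso_sum_bot`); m = 0 is the hypothesis that U is L-DS. The content is that for m ≥ 1 such
a Q has an isolated vertex.

Suppose it has none, and let n be the order of U. The first two spectral moments give Q a vertex of
degree at least n - 2, and the multiplicity of 0 gives at least m + 1 components. Counting vertices
leaves only m = 1 and Q = Fᶜ + K_2 with F of order n - 1 (`exists_split_of_lapSpec_eq`). Hence the
spectrum of U with 1 adjoined is the spectrum of F shifted by 1 with 0 and n - 2 adjoined. The first
moment gives F exactly two edges; the next two constrain the degrees of U (`power_sum_facts`).

If the edges of F are disjoint, U is C_6, which is excluded. If they share a vertex, U has a vertex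
of degree n - 3. For n ≥ 6 this forces an eigenvalue above n - 2 (`exists_lt_mem_lapSpec`), while
`le_of_mem_lapSpec` keeps the prescribed spectrum at or below n - 2; for n = 5, U is C_5, which
lacks the eigenvalue 3. The exception is genuine: F = 2P_2 + K_1 produces the mate of C_6 × K_1. -/

/-! ### Spectra of disjoint unions and complements -/

theorem lapSpec_eq {V : Type*} [Fintype V] [DecidableEq V] (G : SimpleGraph V)
    [DecidableRel G.Adj] : lapSpec G = (G.lapMatrix ℝ).charpoly.roots := by
  unfold lapSpec
  congr!

open Classical in
theorem lapSpec_iso {V W : Type*} [Fintype V] [Fintype W] {G : SimpleGraph V}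
    {H : SimpleGraph W} (e : G ≃g H) : lapSpec G = lapSpec H := by
  rw [lapSpec_eq, lapSpec_eq, ← Matrix.charpoly_reindex e.toEquiv]
  congr 2
  ext i j
  have h1 : ∀ v, G.degree (e.symm v) = H.degree v := fun v => e.symm.degree_eq v
  have h2 : G.Adj (e.symm i) (e.symm j) ↔ H.Adj i j := e.symm.map_adj_iff
  have h3 : e.toEquiv.symm i = e.symm i := rfl
  have h4 : e.toEquiv.symm j = e.symm j := rfl
  simp only [reindex_apply, submatrix_apply, SimpleGraph.lapMatrix, SimpleGraph.degMatrix,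
    Matrix.sub_apply, diagonal_apply, SimpleGraph.adjMatrix_apply, h3, h4, h1, h2,
    EmbeddingLike.apply_eq_iff_eq]

open Classical in
theorem card_lapSpec {V : Type*} [Fintype V] (G : SimpleGraph V) :
    Multiset.card (lapSpec G) = Fintype.card V := by
  rw [lapSpec_eq, (G.isHermitian_lapMatrix ℝ).roots_charpoly_eq_eigenvalues]
  simp

theorem sum_degree_inl {V W : Type*} (G : SimpleGraph V) (H : SimpleGraph W) (v : V)
    [Fintype ((G.sum H).neighborSet (Sum.inl v))] [Fintype (G.neighborSet v)] :
    (G.sum H).degree (Sum.inl v) = G.degree v := by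
  rw [← SimpleGraph.card_neighborSet_eq_degree, ← SimpleGraph.card_neighborSet_eq_degree,
    ← Nat.card_eq_fintype_card, ← Nat.card_eq_fintype_card, SimpleGraph.neighborSet_sum_inl,
    Nat.card_image_of_injective Sum.inl_injective]

theorem sum_degree_inr {V W : Type*} (G : SimpleGraph V) (H : SimpleGraph W) (v : W)
    [Fintype ((G.sum H).neighborSet (Sum.inr v))] [Fintype (H.neighborSet v)] :
    (G.sum H).degree (Sum.inr v) = H.degree v := by
  rw [← SimpleGraph.card_neighborSet_eq_degree, ← SimpleGraph.card_neighborSet_eq_degree,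
    ← Nat.card_eq_fintype_card, ← Nat.card_eq_fintype_card, SimpleGraph.neighborSet_sum_inr,
    Nat.card_image_of_injective Sum.inr_injective]

open Classical in
theorem lapSpec_sum {V W : Type*} [Fintype V] [Fintype W] (G : SimpleGraph V)
    (H : SimpleGraph W) : lapSpec (G.sum H) = lapSpec G + lapSpec H := by
  have h : (G.sum H).lapMatrix ℝ = fromBlocks (G.lapMatrix ℝ) 0 0 (H.lapMatrix ℝ) := by
    ext (i | i) (j | j) <;>
      simp [SimpleGraph.lapMatrix, SimpleGraph.degMatrix, diagonal_apply,
        SimpleGraph.adjMatrix_apply, sum_degree_inl, sum_degree_inr]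
  rw [lapSpec_eq, lapSpec_eq, lapSpec_eq, h, charpoly_fromBlocks_zero₁₂, roots_mul]
  exact ((charpoly_monic _).mul (charpoly_monic _)).ne_zero

open Classical in
theorem lapMatrix_compl {V : Type*} [Fintype V] (G : SimpleGraph V) :
    Gᶜ.lapMatrix ℝ = scalar V (Fintype.card V : ℝ) - of (fun _ _ => 1) - G.lapMatrix ℝ := by
  rw [scalar_apply]
  ext i j
  have hd : (Gᶜ.degree i : ℝ) = Fintype.card V - 1 - G.degree i := by
    have h0 := G.degree_lt_card_verts i
    rw [SimpleGraph.degree_compl, Nat.cast_sub (by omega), Nat.cast_sub (by omega)]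
    simp
  by_cases hij : i = j
  · subst hij
    simp only [SimpleGraph.lapMatrix, SimpleGraph.degMatrix, Matrix.sub_apply, diagonal_apply, if_true,
      SimpleGraph.adjMatrix_apply, SimpleGraph.irrefl, if_false, of_apply, hd]
    ring
  · by_cases ha : G.Adj i j <;>
    simp [SimpleGraph.lapMatrix, SimpleGraph.degMatrix, SimpleGraph.adjMatrix_apply, hij, ha]

open Classical in
theorem lapMatrix_mul_ones {V : Type*} [Fintype V] (G : SimpleGraph V) :
    G.lapMatrix ℝ * (of (fun _ _ => 1) : Matrix V V ℝ) = 0 := by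
  ext i j
  have := congrFun (G.lapMatrix_mulVec_const_eq_zero (R := ℝ)) i
  simpa [mulVec, dotProduct, mul_apply] using this

/-- Write J for the all-ones matrix. Since MJ = 0, y + M + J = (y + M)(1 + J/y), and the rank-one
determinant formula gives the factor 1 + n/y. At y = 0 the constant vector shows that M is singular.
-/
theorem det_add_ones {V : Type*} [Fintype V] [DecidableEq V] [Nonempty V] (M : Matrix V V ℝ)
    (hM : M * of (fun _ _ => 1) = 0) (y : ℝ) :
    y * (scalar V y + M + of (fun _ _ => 1)).det
      = (y + Fintype.card V) * (scalar V y + M).det := by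
  rcases eq_or_ne y 0 with rfl | hy
  · have : M.det = 0 := by
      rw [← exists_mulVec_eq_zero_iff]
      refine ⟨fun _ => 1, fun h => one_ne_zero (congrFun h (Classical.arbitrary V)), ?_⟩
      ext i
      simpa [mulVec, dotProduct, mul_apply] using congrFun (congrFun hM i) i
    simp [this]
  · have h1 : scalar V y + M + of (fun _ _ => 1)
        = (scalar V y + M) * (1 + replicateCol Unit (fun _ : V => y⁻¹) *
          replicateRow Unit (fun _ : V => (1 : ℝ))) := by
      have h2 : replicateCol Unit (fun _ : V => y⁻¹) * replicateRow Unit (fun _ : V => (1 : ℝ))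
          = y⁻¹ • of (fun _ _ => 1) := by
        ext i j
        simp [mul_apply]
      rw [h2, mul_add, mul_one, mul_smul_comm, add_mul, hM, add_zero]
      congr 1
      ext i j
      simp [hy]
    rw [h1, det_mul, det_one_add_replicateCol_mul_replicateRow]
    simp only [dotProduct, one_mul, Finset.sum_const, Finset.card_univ, nsmul_eq_mul]
    field_simp

-- Constant vectors have eigenvalue 0 in both graphs; on their orthogonal complement the Laplacians
-- sum to n. The adjoined n and 0 account for the constants without erasing an element of either
-- multiset.
open Classical in
theorem lapSpec_compl {V : Type*} [Fintype V] [Nonempty V] (G : SimpleGraph V) :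
    (Fintype.card V : ℝ) ::ₘ lapSpec Gᶜ
      = 0 ::ₘ (lapSpec G).map (fun x => (Fintype.card V : ℝ) - x) := by
  have hG := G.isHermitian_lapMatrix ℝ
  obtain ⟨n, hn⟩ : ∃ n : ℝ, n = (Fintype.card V : ℝ) := ⟨_, rfl⟩
  rw [← hn]
  have key : (X - C n) * (Gᶜ.lapMatrix ℝ).charpoly
      = (X - C 0) * ∏ i, (X - C (n - hG.eigenvalues i)) := by
    refine Polynomial.funext fun x => ?_
    have e1 : scalar V x - Gᶜ.lapMatrix ℝ
        = scalar V (x - n) + G.lapMatrix ℝ + of (fun _ _ => 1) := by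
      rw [lapMatrix_compl, map_sub, hn]; abel
    have e2 : (scalar V (x - n) + G.lapMatrix ℝ).det = ∏ i, (x - (n - hG.eigenvalues i)) := by
      have : scalar V (x - n) + G.lapMatrix ℝ = -(scalar V (n - x) - G.lapMatrix ℝ) := by
        rw [map_sub, map_sub]; abel
      rw [this, det_neg, ← eval_charpoly, hG.charpoly_eq, eval_prod, Fintype.card,
        ← Finset.prod_const, ← Finset.prod_mul_distrib]
      refine Finset.prod_congr rfl fun i _ => ?_
      simp only [eval_sub, eval_X, eval_C, RCLike.ofReal_real_eq_id, id]
      ring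
    have e3 := det_add_ones _ (lapMatrix_mul_ones G) (x - n)
    rw [eval_mul, eval_mul, eval_charpoly, eval_prod, e1]
    simp only [eval_sub, eval_X, eval_C]
    rw [e3, e2, ← hn]
    ring
  have h2 := congrArg roots key
  rw [roots_mul (mul_ne_zero (X_sub_C_ne_zero _) (charpoly_monic _).ne_zero),
    roots_mul (mul_ne_zero (X_sub_C_ne_zero _) (Finset.prod_ne_zero_iff.2
      fun i _ => X_sub_C_ne_zero _)), roots_X_sub_C, roots_X_sub_C, ← lapSpec_eq] at h2
  have h3 : (∏ i, (X - C (n - hG.eigenvalues i))).roots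
      = (lapSpec G).map (fun x => n - x) := by
    rw [lapSpec_eq, hG.roots_charpoly_eq_eigenvalues, Multiset.map_map]
    have := roots_multiset_prod_X_sub_C (Finset.univ.val.map (fun i => n - hG.eigenvalues i))
    rw [Multiset.map_map] at this
    exact this
  rw [h3] at h2
  simpa only [Multiset.singleton_add] using h2

/-! ### Moments, eigenvectors, the quadratic form and the multiplicity of 0 -/

open Classical in
theorem sum_pow_lapSpec {V : Type*} [Fintype V] (G : SimpleGraph V) (k : ℕ) :
    ((lapSpec G).map (· ^ k)).sum = ((G.lapMatrix ℝ) ^ k).trace := by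
  have hG := G.isHermitian_lapMatrix ℝ
  rw [lapSpec_eq, hG.roots_charpoly_eq_eigenvalues, Multiset.map_map]
  conv_rhs => rw [hG.spectral_theorem, ← map_pow, diagonal_pow, Unitary.conjStarAlgAut_apply,
    trace_mul_cycle, Unitary.coe_star_mul_self, one_mul, trace_diagonal]
  rfl

open Classical in
theorem exists_eigenvector {V : Type*} [Fintype V] {G : SimpleGraph V} {μ : ℝ}
    (h : μ ∈ lapSpec G) : ∃ x : V → ℝ, x ≠ 0 ∧ G.lapMatrix ℝ *ᵥ x = μ • x := by
  rw [lapSpec_eq] at h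
  have h1 := (mem_roots'.1 h).2
  rw [IsRoot, eval_charpoly, ← exists_mulVec_eq_zero_iff] at h1
  obtain ⟨x, hx, h2⟩ := h1
  refine ⟨x, hx, ?_⟩
  rw [sub_mulVec, sub_eq_zero] at h2
  rw [← h2]
  ext i
  simp [scalar_apply, mulVec_diagonal]

open Classical in
theorem quadratic_form_le {V : Type*} [Fintype V] {G : SimpleGraph V} {c : ℝ}
    (h : ∀ μ ∈ lapSpec G, μ ≤ c) (x : V → ℝ) :
    x ⬝ᵥ (G.lapMatrix ℝ *ᵥ x) ≤ c * (x ⬝ᵥ x) := by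
  have hG := G.isHermitian_lapMatrix ℝ
  have hB : (scalar V c - G.lapMatrix ℝ).IsHermitian :=
    (isHermitian_diagonal _).sub hG
  have hp : (scalar V c - G.lapMatrix ℝ).PosSemidef := by
    rw [hB.posSemidef_iff_eigenvalues_nonneg]
    intro i
    have h1 := hB.eigenvalues_mem_spectrum_real i
    rw [mem_spectrum_iff_isRoot_charpoly, IsRoot, eval_charpoly] at h1
    have h2 : c - hB.eigenvalues i ∈ lapSpec G := by
      rw [lapSpec_eq, mem_roots (charpoly_monic _).ne_zero, IsRoot, eval_charpoly]
      have : scalar V (c - hB.eigenvalues i) - G.lapMatrix ℝ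
        = -(scalar V (hB.eigenvalues i) - (scalar V c - G.lapMatrix ℝ)) := by
        rw [map_sub]; abel
      rw [this, det_neg, h1, mul_zero]
    have := h _ h2
    simp only [Pi.zero_apply]
    linarith
  have h3 := hp.dotProduct_mulVec_nonneg x
  rw [sub_mulVec, dotProduct_sub] at h3
  have h4 : scalar V c *ᵥ x = c • x := by
    ext i
    simp [scalar_apply, mulVec_diagonal]
  rw [h4, dotProduct_smul] at h3
  simp only [star_trivial, smul_eq_mul] at h3
  linarith

open Classical in
theorem count_zero_lapSpec {V : Type*} [Fintype V] (G : SimpleGraph V)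
    [Fintype G.ConnectedComponent] :
    (lapSpec G).count 0 = Fintype.card G.ConnectedComponent := by
  have hG := G.isHermitian_lapMatrix ℝ
  have h1 := hG.rank_eq_card_non_zero_eigs
  have h2 := LinearMap.finrank_range_add_finrank_ker (G.lapMatrix ℝ).toLin'
  have h0 : Fintype.card G.ConnectedComponent
      = Module.finrank ℝ (LinearMap.ker (G.lapMatrix ℝ).toLin') := by
    rw [← SimpleGraph.card_connectedComponent_eq_finrank_ker_toLin'_lapMatrix]
    congr!
  rw [h0, lapSpec_eq,
    hG.roots_charpoly_eq_eigenvalues, Multiset.count_map]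
  have h3 : (G.lapMatrix ℝ).rank = Module.finrank ℝ (LinearMap.range (G.lapMatrix ℝ).toLin') := rfl
  rw [← h3, h1, Fintype.card_subtype, Module.finrank_fintype_fun_eq_card, ← Finset.card_univ,
    ← Finset.card_filter_add_card_filter_not (s := Finset.univ)
      (fun i => hG.eigenvalues i ≠ 0)] at h2
  have h4 := Nat.add_left_cancel h2
  rw [h4]
  simp only [not_not]
  rw [Finset.card_def, Finset.filter_val]
  congr 1
  refine Multiset.filter_congr fun i _ => ?_
  simp [eq_comm]

open Classical in
theorem trace_lapMatrix {V : Type*} [Fintype V] (G : SimpleGraph V) :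
    (G.lapMatrix ℝ).trace = ∑ v, (G.degree v : ℝ) := by
  simp [SimpleGraph.lapMatrix, SimpleGraph.degMatrix, trace_sub]

open Classical in
theorem trace_lapMatrix_sq {V : Type*} [Fintype V] (G : SimpleGraph V) :
    (G.lapMatrix ℝ ^ 2).trace = ∑ v, ((G.degree v : ℝ) ^ 2 + G.degree v) := by
  set D := G.degMatrix ℝ with hD
  set A := G.adjMatrix ℝ with hA
  have h1 : (D * A).trace = 0 := by
    simp only [trace, diag_apply, hD, hA, SimpleGraph.degMatrix, diagonal_mul,
      SimpleGraph.adjMatrix_apply, SimpleGraph.irrefl, if_false, mul_zero, Finset.sum_const_zero]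
  have h2 : (A * A).trace = ∑ v, (G.degree v : ℝ) := by
    simp only [trace, diag_apply, hA, SimpleGraph.adjMatrix_mul_self_apply_self]
  have h3 : (D * D).trace = ∑ v, (G.degree v : ℝ) ^ 2 := by
    simp [hD, SimpleGraph.degMatrix, diagonal_mul_diagonal, sq]
  have h4 : G.lapMatrix ℝ ^ 2 = D * D - D * A - A * D + A * A := by
    rw [SimpleGraph.lapMatrix]; noncomm_ring
  rw [h4, trace_add, trace_sub, trace_sub, trace_mul_comm A D, h1, h2, h3,
    Finset.sum_add_distrib]
  ring

open Classical in
theorem trace_lapMatrix_cube {V : Type*} [Fintype V] (G : SimpleGraph V) :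
    (G.lapMatrix ℝ ^ 3).trace
      = ∑ v, ((G.degree v : ℝ) ^ 3 + 3 * (G.degree v : ℝ) ^ 2) - (G.adjMatrix ℝ ^ 3).trace := by
  set D := G.degMatrix ℝ with hD
  set A := G.adjMatrix ℝ with hA
  have h1 : (D * D * A).trace = 0 := by
    simp only [trace, diag_apply, hD, hA, SimpleGraph.degMatrix, diagonal_mul_diagonal,
      diagonal_mul, SimpleGraph.adjMatrix_apply, SimpleGraph.irrefl, if_false, mul_zero,
      Finset.sum_const_zero]
  have h2 : (D * (A * A)).trace = ∑ v, (G.degree v : ℝ) ^ 2 := by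
    simp only [trace, diag_apply, hA, hD, SimpleGraph.degMatrix, diagonal_mul,
      SimpleGraph.adjMatrix_mul_self_apply_self, sq]
  have h3 : (D * D * D).trace = ∑ v, (G.degree v : ℝ) ^ 3 := by
    simp [hD, SimpleGraph.degMatrix, diagonal_mul_diagonal, pow_succ]
  have h4 : G.lapMatrix ℝ ^ 3 = D * D * D - D * D * A - D * (A * D) - A * (D * D)
      + D * (A * A) + A * (D * A) + A * (A * D) - A ^ 3 := by
    rw [SimpleGraph.lapMatrix]; noncomm_ring
  have h5 : (D * (A * D)).trace = 0 := by
    rw [trace_mul_comm, mul_assoc, trace_mul_comm, h1]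
  have h6 : (A * (D * D)).trace = 0 := by
    rw [trace_mul_comm, h1]
  have h7 : (A * (D * A)).trace = ∑ v, (G.degree v : ℝ) ^ 2 := by
    rw [trace_mul_comm, mul_assoc, h2]
  have h8 : (A * (A * D)).trace = ∑ v, (G.degree v : ℝ) ^ 2 := by
    rw [← mul_assoc, trace_mul_comm, h2]
  rw [h4]
  simp only [trace_add, trace_sub, h1, h2, h3, h5, h6, h7, h8, Finset.sum_add_distrib,
    ← Finset.mul_sum]
  ring

open Classical in
theorem trace_adjMatrix_cube {V : Type*} [Fintype V] (G : SimpleGraph V) :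
    (G.adjMatrix ℝ ^ 3).trace
      = ∑ i, ∑ j, ∑ k, if G.Adj i k ∧ G.Adj k j ∧ G.Adj j i then (1 : ℝ) else 0 := by
  simp only [pow_succ, pow_zero, one_mul, trace, diag_apply, mul_apply,
    SimpleGraph.adjMatrix_apply, Finset.sum_mul]
  refine Finset.sum_congr rfl fun i _ => Finset.sum_congr rfl fun j _ =>
    Finset.sum_congr rfl fun k _ => ?_
  split_ifs <;> simp_all

open Classical in
theorem trace_adjMatrix_cube_nonneg {V : Type*} [Fintype V] (G : SimpleGraph V) :
    0 ≤ (G.adjMatrix ℝ ^ 3).trace := by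
  rw [trace_adjMatrix_cube]
  refine Finset.sum_nonneg fun i _ => Finset.sum_nonneg fun j _ => Finset.sum_nonneg fun k _ => ?_
  split_ifs <;> norm_num

/-! ### Upper and lower bounds for the largest eigenvalue -/

-- The Anderson–Morley bound. On an edge uv maximising |x u - x v|, subtracting the two eigenvector
-- equations gives μ ≤ deg u + deg v unless the maximum is 0, in which case x vanishes. The
-- condition 0 ≤ c makes an offending μ positive, which also settles edgeless graphs.
open Classical in
theorem le_of_mem_lapSpec {V : Type*} [Fintype V] {G : SimpleGraph V} {c : ℝ} (hc : 0 ≤ c)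
    (h : ∀ u v, G.Adj u v → (G.degree u + G.degree v : ℝ) ≤ c) {μ : ℝ} (hμ : μ ∈ lapSpec G) :
    μ ≤ c := by
  obtain ⟨x, hx, hL⟩ := exists_eigenvector hμ
  by_contra! hlt
  have hrow : ∀ v, μ * x v = ∑ u ∈ G.neighborFinset v, (x v - x u) := by
    intro v
    have := congrFun hL v
    rw [SimpleGraph.lapMatrix_mulVec_apply] at this
    simp only [Pi.smul_apply, smul_eq_mul] at this
    rw [← this, Finset.sum_sub_distrib]
    simp
  by_cases hE : ∃ p : V × V, G.Adj p.1 p.2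
  · let S := Finset.univ.filter fun p : V × V => G.Adj p.1 p.2
    have hS : S.Nonempty := hE.imp fun p hp => by simpa [S] using hp
    obtain ⟨⟨u, v⟩, huv, hmax⟩ := S.exists_max_image (fun p => |x p.1 - x p.2|) hS
    have huv' : G.Adj u v := by simpa [S] using huv
    have hmax' : ∀ a b, G.Adj a b → |x a - x b| ≤ |x u - x v| := fun a b hab =>
      hmax (a, b) (by simpa [S] using hab)
    have hb : ∀ a, |μ * x a| ≤ G.degree a * |x u - x v| := by
      intro a
      rw [hrow]
      refine (Finset.abs_sum_le_sum_abs _ _).trans ?_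
      refine (Finset.sum_le_card_nsmul _ _ _ fun b hb => hmax' a b (by simpa using hb)).trans ?_
      simp
    have h1 : μ * |x u - x v| ≤ (G.degree u + G.degree v) * |x u - x v| := by
      have e1 : μ * |x u - x v| = |μ * x u - μ * x v| := by
        rw [← mul_sub, abs_mul, abs_of_pos (hc.trans_lt hlt)]
      rw [e1, add_mul]
      exact (abs_sub _ _).trans (add_le_add (hb u) (hb v))
    have h2 : |x u - x v| = 0 := by
      by_contra hne
      have hpos : 0 < |x u - x v| := lt_of_le_of_ne (abs_nonneg _) (Ne.symm hne)
      have := le_of_mul_le_mul_right h1 hpos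
      linarith [h u v huv']
    refine hx (funext fun a => ?_)
    have h3 := hb a
    rw [h2, mul_zero, abs_nonpos_iff] at h3
    exact (mul_eq_zero.1 h3).resolve_left (by linarith)
  · push Not at hE
    refine hx (funext fun a => ?_)
    have h3 := hrow a
    have : G.neighborFinset a = ∅ := by
      ext b
      simpa using hE (a, b)
    rw [this, Finset.sum_empty] at h3
    exact (mul_eq_zero.1 h3).resolve_left (by linarith)

theorem exists_adj_mem_notMem {V : Type*} {G : SimpleGraph V} (hG : G.Connected)
    {s : Set V} {a b : V} (ha : a ∈ s) (hb : b ∉ s) : ∃ u ∈ s, ∃ v ∉ s, G.Adj u v := by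
  by_contra! h
  obtain ⟨p⟩ := hG.preconnected a b
  have : ∀ {u v : V}, G.Walk u v → u ∈ s → v ∈ s := by
    intro u v p
    induction p with
    | nil => exact id
    | cons hadj _ ih => exact fun hu => ih (by_contra fun hv => h _ hu _ hv hadj)
  exact hb (this p ha)

-- The star at v already gives Rayleigh quotient d + 1, with test vector d at v and -1 on its
-- neighbours. Connectedness supplies one more edge leaving the closed neighbourhood, which makes
-- the inequality strict.
open Classical in
theorem exists_lt_mem_lapSpec {V : Type*} [Fintype V] {G : SimpleGraph V} (hG : G.Connected)
    (v : V) (hv : G.degree v + 1 < Fintype.card V) : ∃ μ ∈ lapSpec G, (G.degree v : ℝ) + 1 < μ := by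
  by_contra! hle
  set d := (G.degree v : ℝ) with hd
  let x : V → ℝ := fun i => if i = v then d else if G.Adj v i then -1 else 0
  have hq := quadratic_form_le hle x
  have hsumN : ∀ c : ℝ, ∑ i, (if G.Adj v i then c else 0) = d * c := by
    intro c
    rw [hd, ← Finset.sum_filter, Finset.sum_const, nsmul_eq_mul,
      ← SimpleGraph.card_neighborFinset_eq_degree, SimpleGraph.neighborFinset_eq_filter]
  have hxx : x ⬝ᵥ x = d ^ 2 + d := by
    have : ∀ i, x i * x i = (if i = v then d ^ 2 else 0) + if G.Adj v i then 1 else 0 := by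
      intro i
      by_cases h1 : i = v
      · subst h1; simp [x, sq]
      · by_cases h2 : G.Adj v i <;> simp [x, h1, h2]
    simp only [dotProduct, this, Finset.sum_add_distrib, hsumN]
    simp
  obtain ⟨b, hb⟩ : ∃ b, b ∉ insert v (G.neighborSet v) := by
    by_contra! hall
    have h1 : (Finset.univ : Finset V) ⊆ insert v (G.neighborFinset v) := by
      intro b _
      simpa using hall b
    have h2 := (Finset.card_le_card h1).trans (Finset.card_insert_le _ _)
    rw [Finset.card_univ, SimpleGraph.card_neighborFinset_eq_degree] at h2
    omega
  obtain ⟨a, ha, w, hw, haw⟩ := exists_adj_mem_notMem hG (Set.mem_insert v _) hb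
  have hwv : w ≠ v := fun h => hw (by simp [h])
  have hnw : ¬ G.Adj v w := fun h => hw (by simp [h])
  have hav : a ≠ v := by
    rintro rfl
    exact hnw haw
  have hva : G.Adj v a := by simpa [hav] using ha
  have hquad : x ⬝ᵥ (G.lapMatrix ℝ *ᵥ x)
      = (∑ i, ∑ j, if G.Adj i j then (x i - x j) ^ 2 else 0) / 2 := by
    rw [← SimpleGraph.lapMatrix_toLinearMap₂' ℝ G x, Matrix.toLinearMap₂'_apply']
  have hxv : x v = d := by simp [x]
  have hxN : ∀ i, G.Adj v i → x i = -1 := fun i hi => by simp [x, hi, hi.ne']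
  -- Each star edge is counted from both ends, the extra edge only from `w`; after halving, the
  -- excess 1/2 suffices.
  have hlow : ∀ i, (if i = v then d * (d + 1) ^ 2 else 0) + (if G.Adj v i then (d + 1) ^ 2 else 0)
      + (if i = w then 1 else 0) ≤ ∑ j, if G.Adj i j then (x i - x j) ^ 2 else 0 := by
    intro i
    have hnn : ∀ j ∈ Finset.univ, 0 ≤ if G.Adj i j then (x i - x j) ^ 2 else 0 := by
      intro j _
      split_ifs <;> positivity
    by_cases h1 : i = v
    · subst h1
      rw [if_pos rfl, if_neg (G.loopless.irrefl i), if_neg hwv.symm, add_zero, add_zero,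
        ← hsumN]
      refine Finset.sum_le_sum fun j _ => ?_
      by_cases h2 : G.Adj i j
      · rw [if_pos h2, if_pos h2, hxv, hxN j h2]
        apply le_of_eq; ring
      · rw [if_neg h2, if_neg h2]
    · by_cases h2 : G.Adj v i
      · have h3 : i ≠ w := by rintro rfl; exact hnw h2
        rw [if_neg h1, if_pos h2, if_neg h3, zero_add, add_zero]
        refine le_trans ?_ (Finset.single_le_sum hnn (Finset.mem_univ v))
        rw [if_pos h2.symm, hxv, hxN i h2]
        apply le_of_eq; ring
      · rw [if_neg h1, if_neg h2]
        by_cases h3 : i = w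
        · subst h3
          refine le_trans ?_ (Finset.single_le_sum hnn (Finset.mem_univ a))
          rw [if_pos rfl, if_pos haw.symm, hxN a hva]
          simp [x, h1, h2]
        · rw [if_neg h3]
          simpa using Finset.sum_nonneg hnn
  have htot := Finset.sum_le_sum fun i (_ : i ∈ Finset.univ) => hlow i
  simp only [Finset.sum_add_distrib, hsumN] at htot
  simp only [Finset.sum_ite_eq', Finset.mem_univ, if_true] at htot
  rw [hxx, hquad] at hq
  nlinarith

/-! ### Edge count of a unicyclic graph -/

/-- An edge of the cycle is not a bridge, so deleting it keeps the graph connected. A surviving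
cycle would, by uniqueness, contain the deleted edge. -/
theorem IsUnicyclic.exists_isTree_deleteEdges {V : Type*} {G : SimpleGraph V}
    (hG : IsUnicyclic G) : ∃ e ∈ G.edgeSet, (G.deleteEdges {e}).IsTree := by
  obtain ⟨hc, S, ⟨v, c, hcyc, hS⟩, huniq⟩ := hG
  obtain ⟨a, b, hab⟩ : ∃ a b, s(a, b) ∈ c.edges := by
    have hne : c.edges ≠ [] := by
      intro h
      have := hcyc.three_le_length
      rw [← SimpleGraph.Walk.length_edges, h] at this
      simp at this
    obtain ⟨e, he⟩ := List.exists_mem_of_ne_nil _ hne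
    induction e with
    | h a b => exact ⟨a, b, he⟩
  refine ⟨s(a, b), c.edges_subset_edgeSet hab, ?_, ?_⟩
  · refine hc.connected_delete_edge_of_not_isBridge ?_
    rw [SimpleGraph.isBridge_iff_forall_cycle_notMem (c.edges_subset_edgeSet hab)]
    exact fun h => h c hcyc hab
  · intro u p hp
    have hle : G.deleteEdges {s(a, b)} ≤ G := SimpleGraph.deleteEdges_le _
    have h1 := huniq _ ⟨u, p.mapLe hle, hp.mapLe hle, rfl⟩
    have h2 : s(a, b) ∈ (p.mapLe hle).toSubgraph.edgeSet := by
      rw [h1, ← hS]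
      exact SimpleGraph.Walk.mem_edges_toSubgraph c |>.2 hab
    rw [SimpleGraph.Walk.mem_edges_toSubgraph, SimpleGraph.Walk.edges_mapLe_eq_edges] at h2
    have h3 := p.edges_subset_edgeSet h2
    simp at h3

open Classical in
theorem IsUnicyclic.sum_degree {V : Type*} [Fintype V] {G : SimpleGraph V}
    (hG : IsUnicyclic G) : ∑ v, G.degree v = 2 * Fintype.card V := by
  obtain ⟨e, he, ht⟩ := hG.exists_isTree_deleteEdges
  have h1 := ht.card_edgeFinset
  rw [SimpleGraph.sum_degrees_eq_twice_card_edges]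
  have h2 : (G.deleteEdges {e}).edgeFinset = G.edgeFinset.erase e := by
    ext x
    simp [and_comm]
  have h3 : e ∈ G.edgeFinset := by simpa using he
  rw [h2, Finset.card_erase_of_mem h3] at h1
  have := Finset.card_pos.2 ⟨e, h3⟩
  omega

theorem IsUnicyclic.three_le_card {V : Type*} [Fintype V] {G : SimpleGraph V}
    (hG : IsUnicyclic G) : 3 ≤ Fintype.card V := by
  obtain ⟨-, S, ⟨v, c, hcyc, -⟩, -⟩ := hG
  classical
  have h1 := hcyc.three_le_length
  have h2 := hcyc.support_nodup
  have h3 := List.Nodup.length_le_card h2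
  simp at h3
  omega

/-! ### Edgeless graphs, K_2 and splitting along a union of components -/

open Classical in
theorem lapSpec_bot (V : Type*) [Fintype V] :
    lapSpec (⊥ : SimpleGraph V) = Multiset.replicate (Fintype.card V) 0 := by
  have h : (⊥ : SimpleGraph V).lapMatrix ℝ = 0 := by
    ext i j
    simp [SimpleGraph.lapMatrix, SimpleGraph.degMatrix]
  rw [lapSpec_eq, h, charpoly_zero, roots_pow, roots_X, Multiset.nsmul_singleton]

theorem lapSpec_top_of_card_eq_two {V : Type*} [Fintype V] (h : Fintype.card V = 2) :
    lapSpec (⊤ : SimpleGraph V) = {0, 2} := by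
  have : Nonempty V := Fintype.card_pos_iff.1 (by omega)
  have h1 := lapSpec_compl (⊥ : SimpleGraph V)
  rw [lapSpec_bot, compl_bot, h, Multiset.map_replicate] at h1
  have h2 : (0 : ℝ) ::ₘ Multiset.replicate 2 ((2 : ℕ) - 0 : ℝ) = ((2 : ℕ) : ℝ) ::ₘ {0, 2} := by
    simp only [Nat.cast_ofNat, sub_zero, Multiset.replicate_succ, Multiset.replicate_zero]
    rw [Multiset.cons_swap]
    rfl
  rw [h2] at h1
  exact (Multiset.cons_inj_right _).1 h1

/-- A graph is the disjoint union of the subgraphs induced on two complementary sets without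
edges between them. -/
noncomputable def sumInduceIso {V : Type*} (G : SimpleGraph V) (s : Set V)
    (h : ∀ a ∈ s, ∀ b ∉ s, ¬ G.Adj a b) : (G.induce s).sum (G.induce sᶜ) ≃g G := by
  classical
  exact
  { toEquiv := Equiv.Set.sumCompl s
    map_rel_iff' := by
      rintro (⟨a, ha⟩ | ⟨a, ha⟩) (⟨b, hb⟩ | ⟨b, hb⟩)
      · simp
      · simpa using h a ha b hb
      · simpa using fun hab : G.Adj a b => h b hb a ha hab.symm
      · simp }

open Classical in
theorem lapSpec_eq_induce_add {V : Type*} [Fintype V] (G : SimpleGraph V) (s : Set V)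
    (h : ∀ a ∈ s, ∀ b ∉ s, ¬ G.Adj a b) :
    lapSpec G = lapSpec (G.induce s) + lapSpec (G.induce sᶜ) := by
  rw [← lapSpec_sum]
  exact (lapSpec_iso (sumInduceIso G s h)).symm

theorem sum_lapSpec {V : Type*} [Fintype V] (G : SimpleGraph V)
    [∀ v, Fintype (G.neighborSet v)] : (lapSpec G).sum = ∑ v, (G.degree v : ℝ) := by
  classical
  have h := sum_pow_lapSpec G 1
  simp only [pow_one, Multiset.map_id', trace_lapMatrix] at h
  convert h

theorem sum_sq_lapSpec {V : Type*} [Fintype V] (G : SimpleGraph V)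
    [∀ v, Fintype (G.neighborSet v)] :
    ((lapSpec G).map (· ^ 2)).sum = ∑ v, ((G.degree v : ℝ) ^ 2 + G.degree v) := by
  classical
  have h := sum_pow_lapSpec G 2
  rw [trace_lapMatrix_sq] at h
  convert h

/-! ### Structure of a cospectral mate without isolated vertices -/

-- Otherwise all degrees d of Q lie in [1, n - 3]. The degrees of Uᶜ average n - 3, so the moments
-- give ∑ d = n(n - 3) and ∑ d² ≥ n(n - 3)². Then ∑ d(n - 3 - d) ≤ 0 makes Q regular of degree n -
-- 3, and its n + m vertices force n = 3, contradicting d ≥ 1.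
open Classical in
theorem exists_le_degree_of_lapSpec_eq {V W : Type*} [Fintype V] [Fintype W]
    {U : SimpleGraph V} {Q : SimpleGraph W} {m : ℕ} (hm : 1 ≤ m)
    (hU : ∑ v, U.degree v = 2 * Fintype.card V)
    (hQ : lapSpec Q = lapSpec Uᶜ + Multiset.replicate m 0) (hiso : ∀ w, ∃ w', Q.Adj w w') :
    ∃ w, Fintype.card V ≤ Q.degree w + 2 := by
  by_contra! hlt
  obtain ⟨n, hn⟩ : ∃ n : ℝ, n = (Fintype.card V : ℝ) := ⟨_, rfl⟩
  have hUc : ∀ v, (Uᶜ.degree v : ℝ) = n - 3 + (2 - U.degree v) := by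
    intro v
    have h0 := U.degree_lt_card_verts v
    rw [SimpleGraph.degree_compl, Nat.cast_sub (by omega), Nat.cast_sub (by omega), hn]
    push_cast
    ring
  have hz : ∑ v, (2 - (U.degree v : ℝ)) = 0 := by
    rw [Finset.sum_sub_distrib, ← Nat.cast_sum, hU]
    simp [mul_comm]
  have h1 : ∑ w, (Q.degree w : ℝ) = n * (n - 3) := by
    rw [← sum_lapSpec, hQ, Multiset.sum_add, sum_lapSpec]
    simp only [hUc, Finset.sum_add_distrib, hz]
    simp [hn, mul_sub]
  have h2 : n * (n - 3) ^ 2 ≤ ∑ w, (Q.degree w : ℝ) ^ 2 := by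
    have e1 := sum_sq_lapSpec Q
    rw [hQ, Multiset.map_add, Multiset.sum_add, sum_sq_lapSpec, Finset.sum_add_distrib,
      Finset.sum_add_distrib, h1] at e1
    simp only [hUc, Multiset.map_replicate, Multiset.sum_replicate, Finset.sum_add_distrib, hz] at e1
    simp only [add_sq, Finset.sum_add_distrib, ← Finset.mul_sum, hz] at e1
    have e2 : 0 ≤ ∑ v, (2 - (U.degree v : ℝ)) ^ 2 := Finset.sum_nonneg fun _ _ => sq_nonneg _
    simp only [Finset.sum_const, Finset.card_univ, nsmul_eq_mul, ← hn] at e1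
    linarith
  have hpos : ∀ w, (1 : ℝ) ≤ Q.degree w := by
    intro w
    have : 0 < Q.degree w := (Q.degree_pos_iff_exists_adj w).2 (hiso w)
    exact_mod_cast this
  have hle : ∀ w, (Q.degree w : ℝ) ≤ n - 3 := by
    intro w
    have : Q.degree w + 3 ≤ Fintype.card V := by have := hlt w; omega
    rw [hn]
    have h' : ((Q.degree w + 3 : ℕ) : ℝ) ≤ Fintype.card V := by exact_mod_cast this
    push_cast at h'
    linarith
  have hterm : ∀ w ∈ Finset.univ, 0 ≤ (Q.degree w : ℝ) * (n - 3 - Q.degree w) := fun w _ =>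
    mul_nonneg (by linarith [hpos w]) (by linarith [hle w])
  have hsum : ∑ w, (Q.degree w : ℝ) * (n - 3 - Q.degree w) = 0 := by
    refine le_antisymm ?_ (Finset.sum_nonneg hterm)
    simp only [mul_sub, Finset.sum_sub_distrib, ← Finset.sum_mul, h1, ← sq]
    linarith
  have heq : ∀ w, (Q.degree w : ℝ) = n - 3 := by
    intro w
    have := (Finset.sum_eq_zero_iff_of_nonneg hterm).1 hsum w (Finset.mem_univ w)
    rcases mul_eq_zero.1 this with h | h
    · linarith [hpos w]
    · linarith
  have hcard : (Fintype.card W : ℝ) = n + m := by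
    have := congrArg Multiset.card hQ
    rw [Multiset.card_add, card_lapSpec, card_lapSpec, Multiset.card_replicate] at this
    rw [this, hn]
    push_cast
    ring
  simp only [heq, Finset.sum_const, Finset.card_univ, nsmul_eq_mul, hcard] at h1
  have hm' : (1 : ℝ) ≤ m := by exact_mod_cast hm
  have h3 : (m : ℝ) * (n - 3) = 0 := by linarith
  have h4 : n = 3 := by
    rcases mul_eq_zero.1 h3 with h | h <;> linarith
  have hW : 0 < Fintype.card W := by
    have : (0 : ℝ) < Fintype.card W := by rw [hcard]; linarith
    exact_mod_cast this
  obtain ⟨w⟩ := Fintype.card_pos_iff.1 hW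
  linarith [heq w, hpos w]

open Classical in
theorem exists_split_of_lapSpec_eq {V W : Type*} [Fintype V] [Fintype W] [Nonempty V]
    {U : SimpleGraph V} {Q : SimpleGraph W} {m : ℕ} (hm : 1 ≤ m)
    (hU : ∑ v, U.degree v = 2 * Fintype.card V)
    (hQ : lapSpec Q = lapSpec Uᶜ + Multiset.replicate m 0) (hiso : ∀ w, ∃ w', Q.Adj w w') :
    m = 1 ∧ ∃ s : Set W, (∀ a ∈ s, ∀ b ∉ s, ¬ Q.Adj a b) ∧
      Fintype.card s + 1 = Fintype.card V ∧ Fintype.card ↥sᶜ = 2 ∧ Q.induce sᶜ = ⊤ := by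
  obtain ⟨w, hw⟩ := exists_le_degree_of_lapSpec_eq hm hU hQ hiso
  have hcard : Fintype.card W = Fintype.card V + m := by
    have := congrArg Multiset.card hQ
    rwa [Multiset.card_add, card_lapSpec, card_lapSpec, Multiset.card_replicate] at this
  have hk : m + 1 ≤ Fintype.card Q.ConnectedComponent := by
    rw [← count_zero_lapSpec, hQ, Multiset.count_add, count_zero_lapSpec,
      Multiset.count_replicate_self]
    have : 0 < Fintype.card Uᶜ.ConnectedComponent :=
      Fintype.card_pos_iff.2 ⟨Uᶜ.connectedComponentMk (Classical.arbitrary V)⟩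
    omega
  let S : Finset W := insert w (Q.neighborFinset w)
  have hS : Fintype.card V ≤ S.card + 1 := by
    rw [Finset.card_insert_of_notMem (by simp), SimpleGraph.card_neighborFinset_eq_degree]
    omega
  have hSw : ∀ a ∈ S, Q.connectedComponentMk a = Q.connectedComponentMk w := by
    intro a ha
    rcases Finset.mem_insert.1 ha with rfl | h
    · rfl
    · rw [SimpleGraph.mem_neighborFinset] at h
      exact SimpleGraph.ConnectedComponent.sound h.symm.reachable
  let fib : Q.ConnectedComponent → Finset W := fun c =>
    Finset.univ.filter fun a => Q.connectedComponentMk a = c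
  have htot : Fintype.card W = ∑ c, (fib c).card :=
    Finset.card_eq_sum_card_fiberwise fun a _ => Finset.mem_univ _
  have h2 : ∀ c, 2 ≤ (fib c).card := by
    intro c
    induction c using SimpleGraph.ConnectedComponent.ind with
    | h a =>
      obtain ⟨b, hab⟩ := hiso a
      refine le_trans (Finset.card_pair hab.ne).ge (Finset.card_le_card ?_)
      intro x hx
      rcases Finset.mem_insert.1 hx with rfl | hx
      · simp [fib]
      · rw [Finset.mem_singleton.1 hx]
        simpa [fib] using hab.symm.reachable
  have hw0 : S.card ≤ (fib (Q.connectedComponentMk w)).card :=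
    Finset.card_le_card fun a ha => by simpa [fib] using hSw a ha
  -- One component has at least n - 1 vertices and at least m others have two each, so n - 1 + 2m ≤
  -- n + m.
  have hm1 : m = 1 := by
    have e1 := Finset.add_sum_erase Finset.univ (fun c => (fib c).card)
      (Finset.mem_univ (Q.connectedComponentMk w))
    have e2 := Finset.card_nsmul_le_sum (Finset.univ.erase (Q.connectedComponentMk w))
      (fun c => (fib c).card) 2 fun c _ => h2 c
    rw [Finset.card_erase_of_mem (Finset.mem_univ _), Finset.card_univ, smul_eq_mul] at e2
    omega
  refine ⟨hm1, ?_⟩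
  subst hm1
  have : Nontrivial Q.ConnectedComponent := Fintype.one_lt_card_iff_nontrivial.1 (by omega)
  obtain ⟨c, hc⟩ := exists_ne (Q.connectedComponentMk w)
  obtain ⟨x, rfl⟩ : ∃ x, Q.connectedComponentMk x = c := c.exists_rep
  obtain ⟨y, hxy⟩ := hiso x
  have hxS : x ∉ S := fun h => hc (hSw x h)
  have hyc : Q.connectedComponentMk y = Q.connectedComponentMk x :=
    SimpleGraph.ConnectedComponent.sound hxy.symm.reachable
  have hyS : y ∉ S := fun h => hc (hyc ▸ hSw y h)
  have hpair : ({x, y} : Finset W) ⊆ Sᶜ := by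
    intro a ha
    rcases Finset.mem_insert.1 ha with rfl | ha
    · simpa using hxS
    · rw [Finset.mem_singleton.1 ha]; simpa using hyS
  have hcardc := Finset.card_compl S
  have hSc : ({x, y} : Finset W) = Sᶜ := by
    refine Finset.eq_of_subset_of_card_le hpair ?_
    rw [Finset.card_pair hxy.ne]
    omega
  have hmem : ∀ a, a ∉ S → a = x ∨ a = y := by
    intro a ha
    have : a ∈ ({x, y} : Finset W) := by rw [hSc]; simpa using ha
    simpa using this
  have hSc2 : Sᶜ.card = 2 := by rw [← hSc, Finset.card_pair hxy.ne]
  have hScard : ∀ _ : Fintype (S : Set W), Fintype.card (S : Set W) = S.card := fun _ => by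
    rw [← Set.toFinset_card, Finset.toFinset_coe]
  refine ⟨(S : Set W), ?_, ?_, ?_, ?_⟩
  · intro a ha b hb hab
    have hb' : b ∉ S := hb
    have h3 : Q.connectedComponentMk b = Q.connectedComponentMk w :=
      (SimpleGraph.ConnectedComponent.sound hab.symm.reachable).trans (hSw a ha)
    rcases hmem b hb' with rfl | rfl
    · exact hc h3
    · exact hc (hyc ▸ h3)
  · rw [hScard]
    have := S.card_le_univ
    omega
  · rw [Fintype.card_compl_set]
    rw [hScard]
    omega
  · ext ⟨a, ha⟩ ⟨b, hb⟩
    simp only [SimpleGraph.comap_adj, Function.Embedding.subtype_apply, SimpleGraph.top_adj, ne_eq,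
      Subtype.mk.injEq]
    refine ⟨fun h => h.ne, fun hne => ?_⟩
    rcases hmem a ha with rfl | rfl <;> rcases hmem b hb with rfl | rfl
    · exact absurd rfl hne
    · exact hxy
    · exact hxy.symm
    · exact absurd rfl hne

/-! ### Reduction to a graph with two edges -/

/-- Complementing U reflects its spectrum about n/2, complementing F about (n - 1)/2; the mismatch
is the shift by 1. The eigenvalue 2 of K_2 becomes n - 2. -/
theorem lapSpec_add_one_of_compl {V T : Type*} [Fintype V] [Fintype T] [Nonempty V] [Nonempty T]
    {U : SimpleGraph V} {F : SimpleGraph T} (hc : Fintype.card T + 1 = Fintype.card V)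
    (h : lapSpec Uᶜ + {0} = lapSpec Fᶜ + {0, 2}) :
    lapSpec U + {1} = (lapSpec F).map (fun x => 1 + x) + {0, (Fintype.card V : ℝ) - 2} := by
  have hU := lapSpec_compl U
  have hF := lapSpec_compl F
  obtain ⟨n, hn⟩ : ∃ n : ℝ, n = (Fintype.card V : ℝ) := ⟨_, rfl⟩
  have hT : (Fintype.card T : ℝ) = n - 1 := by rw [hn, ← hc]; push_cast; ring
  rw [← hn] at hU ⊢
  rw [hT] at hF
  have h1 : lapSpec Uᶜ = lapSpec Fᶜ + {2} := by
    have : lapSpec Fᶜ + {0, 2} = (lapSpec Fᶜ + {2}) + {0} := by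
      rw [add_assoc]; congr 1; exact Multiset.pair_comm 0 2
    rw [this] at h
    exact add_right_cancel h
  have h2 : ({0} : Multiset ℝ) + (lapSpec U + {1}).map (fun x => n - x)
      = {0} + ((lapSpec F).map (fun x => 1 + x) + {0, n - 2}).map (fun x => n - x) := by
    have e1 : ({0} : Multiset ℝ) + (lapSpec U + {1}).map (fun x => n - x)
        = (0 ::ₘ (lapSpec U).map (fun x => n - x)) + {n - 1} := by
      rw [Multiset.map_add, Multiset.map_singleton, ← add_assoc, Multiset.singleton_add]
    have e2 : ({0} : Multiset ℝ) + ((lapSpec F).map (fun x => 1 + x) + {0, n - 2}).map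
        (fun x => n - x) = (0 ::ₘ (lapSpec F).map (fun x => n - 1 - x)) + {n, 2} := by
      rw [Multiset.map_add, Multiset.map_map, ← add_assoc, Multiset.singleton_add]
      congr 2
      · refine Multiset.map_congr rfl fun x _ => ?_
        simp only [Function.comp_apply]
        ring
      · simp
    rw [e1, e2, ← hU, ← hF, h1, ← Multiset.singleton_add, ← Multiset.singleton_add,
      Multiset.insert_eq_cons, ← Multiset.singleton_add]
    abel
  have h3 := add_left_cancel h2
  exact Multiset.map_injective (fun a b hab => by simpa using hab) h3

-- The two edges are either disjoint or form a path, giving degrees 1, 1, 1, 1 or 2, 1, 1. Both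
-- cases come from comparing deg a, the number of neighbours of a, with the total degree away from
-- a.
open Classical in
theorem degree_facts_of_sum_eq_four {T : Type*} [Fintype T] {F : SimpleGraph T}
    (h : ∑ v, F.degree v = 4) :
    (∀ u v, F.Adj u v → F.degree u + F.degree v ≤ 3) ∧
    ((∑ v, F.degree v ^ 2 = 4 ∧ ∑ v, F.degree v ^ 3 = 4) ∨
      (∑ v, F.degree v ^ 2 = 6 ∧ ∑ v, F.degree v ^ 3 = 10)) := by
  have hcount : ∀ a, ∑ u, (if F.Adj a u then 1 else 0) = F.degree a := by
    intro a
    rw [Finset.sum_boole, ← SimpleGraph.card_neighborFinset_eq_degree,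
      SimpleGraph.neighborFinset_eq_filter]
    simp
  have hle : ∀ a u, (if F.Adj a u then 1 else 0) ≤ F.degree u := by
    intro a u
    split_ifs with hau
    · exact (F.degree_pos_iff_exists_adj u).2 ⟨a, hau.symm⟩
    · exact Nat.zero_le _
  have herase : ∀ a, ∑ u ∈ Finset.univ.erase a, (if F.Adj a u then 1 else 0) = F.degree a := by
    intro a
    have := Finset.add_sum_erase Finset.univ (fun u => if F.Adj a u then 1 else 0)
      (Finset.mem_univ a)
    rw [hcount] at this
    simpa using this
  have hsplit : ∀ (a) (f : T → ℕ), ∑ u, f u = f a + ∑ u ∈ Finset.univ.erase a, f u := fun a f =>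
    (Finset.add_sum_erase Finset.univ f (Finset.mem_univ a)).symm
  have h2 : ∀ a, F.degree a ≤ 2 := by
    intro a
    have e1 := Finset.sum_le_sum fun u (_ : u ∈ Finset.univ.erase a) => hle a u
    rw [herase] at e1
    have e2 := hsplit a (fun u => F.degree u)
    omega
  have h3 : ∀ a, F.degree a = 2 → ∀ u, u ≠ a → F.degree u = if F.Adj a u then 1 else 0 := by
    intro a ha u hu
    have e2 := hsplit a (fun u => F.degree u)
    have e3 : ∑ u ∈ Finset.univ.erase a, (if F.Adj a u then 1 else 0)
        = ∑ u ∈ Finset.univ.erase a, F.degree u := by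
      rw [herase]; omega
    exact ((Finset.sum_eq_sum_iff_of_le fun u _ => hle a u).1 e3 u
      (Finset.mem_erase.2 ⟨hu, Finset.mem_univ u⟩)).symm
  have h4 : ∀ a, F.degree a = 2 → ∀ u, u ≠ a → F.degree u ≤ 1 := by
    intro a ha u hu
    rw [h3 a ha u hu]
    split_ifs <;> omega
  refine ⟨fun u v huv => ?_, ?_⟩
  · have e1 := h2 u
    have e2 := h2 v
    by_contra! hlt
    have := h4 u (by omega) v huv.ne'
    omega
  · by_cases hex : ∃ a, F.degree a = 2
    · obtain ⟨a, ha⟩ := hex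
      right
      have e1 := hsplit a (fun u => F.degree u)
      have e2 : ∀ u ∈ Finset.univ.erase a, F.degree u ^ 2 = F.degree u := by
        intro u hu
        have := h4 a ha u (Finset.ne_of_mem_erase hu)
        interval_cases F.degree u <;> rfl
      have e3 : ∀ u ∈ Finset.univ.erase a, F.degree u ^ 3 = F.degree u := by
        intro u hu
        have := h4 a ha u (Finset.ne_of_mem_erase hu)
        interval_cases F.degree u <;> rfl
      constructor
      · rw [hsplit a, Finset.sum_congr rfl e2]; simp only [ha]; omega
      · rw [hsplit a, Finset.sum_congr rfl e3]; simp only [ha]; omega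
    · left
      push Not at hex
      have e1 : ∀ u, F.degree u ≤ 1 := fun u => by
        have := h2 u
        have := hex u
        omega
      constructor
      · rw [← h]
        refine Finset.sum_congr rfl fun u _ => ?_
        have := e1 u
        interval_cases F.degree u <;> rfl
      · rw [← h]
        refine Finset.sum_congr rfl fun u _ => ?_
        have := e1 u
        interval_cases F.degree u <;> rfl

open Classical in
theorem trace_adjMatrix_cube_eq_zero {T : Type*} [Fintype T] {F : SimpleGraph T}
    (h : ∀ u v, F.Adj u v → F.degree u + F.degree v ≤ 3) : (F.adjMatrix ℝ ^ 3).trace = 0 := by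
  rw [trace_adjMatrix_cube]
  refine Finset.sum_eq_zero fun i _ => Finset.sum_eq_zero fun j _ => Finset.sum_eq_zero fun k _ => ?_
  rw [if_neg]
  rintro ⟨hik, hkj, hji⟩
  have h2 : ∀ a b c, F.Adj a b → F.Adj a c → b ≠ c → 2 ≤ F.degree a := by
    intro a b c hab hac hbc
    rw [← Finset.card_pair hbc, ← SimpleGraph.card_neighborFinset_eq_degree]
    refine Finset.card_le_card fun x hx => ?_
    rcases Finset.mem_insert.1 hx with rfl | hx
    · simpa using hab
    · rw [Finset.mem_singleton.1 hx]; simpa using hac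
  have := h i k hik
  have := h2 i k j hik hji.symm hkj.ne
  have := h2 k i j hik.symm hkj hji.ne'
  omega

/-- Power-sum constraints on a family of natural numbers. The maximum is controlled from above by
the second and from below by the third power sum. -/
theorem power_sum_facts {ι : Type*} [Fintype ι] {e : ι → ℕ} {p : ℤ} {s : ℤ} (hp : 1 ≤ p)
    (h1 : ∑ i, (e i : ℤ) = p + 4) (h2 : ∑ i, (e i : ℤ) ^ 2 = p ^ 2 + 2 + 2 * s)
    (h3 : p ^ 3 - 2 + 6 * s ≤ ∑ i, (e i : ℤ) ^ 3) :
    (s = 0 → p = 2 ∧ ∀ i, e i ≤ 1) ∧ (s = 1 → (∃ v, (e v : ℤ) = p) ∧ ∀ i, (e i : ℤ) ≤ p) := by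
  have hne : Nonempty ι := by
    by_contra hempty
    rw [not_nonempty_iff] at hempty
    simp at h1
    omega
  obtain ⟨v, -, hv⟩ := Finset.exists_max_image Finset.univ e Finset.univ_nonempty
  have hmax : ∀ i, (e i : ℤ) ≤ e v := fun i => by exact_mod_cast hv i (Finset.mem_univ i)
  -- Each e² - e is nonnegative on natural numbers, so the term at the maximum is at most the whole
  -- sum.
  have hsq : ((e v : ℤ)) ^ 2 - e v ≤ p ^ 2 - p - 2 + 2 * s := by
    have hnn : ∀ i ∈ Finset.univ, 0 ≤ (e i : ℤ) ^ 2 - e i := fun i _ => by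
      rcases Nat.eq_zero_or_pos (e i) with h | h
      · simp [h]
      · have : (1 : ℤ) ≤ e i := by exact_mod_cast h
        nlinarith
    have := Finset.single_le_sum hnn (Finset.mem_univ v)
    rw [Finset.sum_sub_distrib, h1, h2] at this
    linarith
  have hcube : ∑ i, (e i : ℤ) ^ 3 ≤ e v * (p ^ 2 + 2 + 2 * s) := by
    rw [← h2, Finset.mul_sum]
    refine Finset.sum_le_sum fun i _ => ?_
    rw [pow_succ, mul_comm]
    exact mul_le_mul_of_nonneg_right (hmax i) (sq_nonneg _)
  have hE : (0 : ℤ) ≤ e v := Int.natCast_nonneg _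
  constructor
  · rintro rfl
    have hlt : (e v : ℤ) ≤ p - 1 := by
      by_contra! hge
      nlinarith
    -- With maximum at most p - 1, the cube sum gives p³ - 2 ≤ (p - 1)(p² + 2), that is p² ≤ 2p.
    have hp2 : p ≤ 2 := by
      have : (e v : ℤ) * (p ^ 2 + 2) ≤ (p - 1) * (p ^ 2 + 2) :=
        mul_le_mul_of_nonneg_right hlt (by positivity)
      nlinarith
    have hp1 : p ≠ 1 := by
      rintro rfl
      have hz : ∀ i, (e i : ℤ) = 0 := fun i => by have := hmax i; omega
      simp [hz] at h1
    obtain rfl : p = 2 := by omega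
    exact ⟨rfl, fun i => by have := hmax i; omega⟩
  · rintro rfl
    have hle : (e v : ℤ) ≤ p := by
      by_contra! hge
      nlinarith
    refine ⟨⟨v, ?_⟩, fun i => (hmax i).trans hle⟩
    by_contra hne'
    have hlt : (e v : ℤ) ≤ p - 1 := by omega
    have : (e v : ℤ) * (p ^ 2 + 2 + 2 * 1) ≤ (p - 1) * (p ^ 2 + 2 + 2 * 1) :=
      mul_le_mul_of_nonneg_right hlt (by positivity)
    -- A maximum below p would give (p - 2)² + 4 ≤ 0.
    nlinarith [sq_nonneg (p - 2)]

/-! ### Recognising cycles, and the spectrum of C_5 -/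

-- The degree condition makes the image of each neighbourhood a full neighbourhood, so no edge
-- leaves the image, and connectedness makes the map onto.
open Classical in
theorem nonempty_iso_of_injective_hom {V W : Type*} [Fintype V] [Fintype W] [Nonempty W]
    {H : SimpleGraph W} {G : SimpleGraph V} (hG : G.Connected) (f : H →g G)
    (hf : Function.Injective f) (hd : ∀ w, G.degree (f w) ≤ H.degree w) : Nonempty (G ≃g H) := by
  have hN : ∀ w, (H.neighborFinset w).image f = G.neighborFinset (f w) := by
    intro w
    refine Finset.eq_of_subset_of_card_le ?_ ?_
    · intro x hx
      obtain ⟨y, hy, rfl⟩ := Finset.mem_image.1 hx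
      rw [SimpleGraph.mem_neighborFinset] at hy ⊢
      exact f.map_adj hy
    · rw [Finset.card_image_of_injective _ hf, SimpleGraph.card_neighborFinset_eq_degree,
        SimpleGraph.card_neighborFinset_eq_degree]
      exact hd w
  have hadj : ∀ w y, G.Adj (f w) y → ∃ w', H.Adj w w' ∧ f w' = y := by
    intro w y hy
    have : y ∈ (H.neighborFinset w).image f := by rw [hN]; simpa using hy
    simpa using this
  have hsurj : Function.Surjective f := by
    intro b
    by_contra hb
    obtain ⟨u, ⟨w, rfl⟩, v, hv, huv⟩ := exists_adj_mem_notMem hG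
      (s := Set.range f) (Set.mem_range_self (Classical.arbitrary W)) hb
    obtain ⟨w', -, rfl⟩ := hadj w v huv
    exact hv (Set.mem_range_self _)
  refine ⟨RelIso.symm ⟨Equiv.ofBijective f ⟨hf, hsurj⟩, ?_⟩⟩
  intro a b
  change G.Adj (f a) (f b) ↔ H.Adj a b
  refine ⟨fun h => ?_, fun h => f.map_adj h⟩
  obtain ⟨w', h1, h2⟩ := hadj a _ h
  rwa [← hf h2]

open Classical in
theorem IsUnicyclic.nonempty_iso_cycleGraph {V : Type*} [Fintype V] {G : SimpleGraph V}
    (hG : IsUnicyclic G) (hd : ∀ v, G.degree v ≤ 2) :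
    Nonempty (G ≃g SimpleGraph.cycleGraph (Fintype.card V)) := by
  obtain ⟨hc, S, ⟨v, c, hcyc, -⟩, -⟩ := hG
  have h3 := hcyc.three_le_length
  obtain ⟨k, hk⟩ : ∃ k, c.length = k + 3 := ⟨c.length - 3, by omega⟩
  obtain ⟨f⟩ := (SimpleGraph.cycleGraph_isContained_iff (G := G) (n := k + 3) (by omega)).2
    ⟨v, c, hcyc, hk⟩
  obtain ⟨e⟩ := nonempty_iso_of_injective_hom hc f.toHom f.injective fun w => by
    refine (hd _).trans (le_of_eq ?_)
    rw [← SimpleGraph.cycleGraph_degree_three_le (v := w)]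
    congr!
  have hcard : Fintype.card V = k + 3 := by
    rw [Fintype.card_congr e.toEquiv, Fintype.card_fin]
  rw [hcard]
  exact ⟨e⟩

theorem eq_zero_of_lapMatrix_cycleGraph_five_mulVec (x : Fin 5 → ℝ)
    (h : (SimpleGraph.cycleGraph 5).lapMatrix ℝ *ᵥ x = (3 : ℝ) • x) : x = 0 := by
  have h' : ∀ i, ((SimpleGraph.cycleGraph 5).lapMatrix ℝ *ᵥ x) i = 3 * x i := fun i => by
    rw [h]; rfl
  simp only [SimpleGraph.lapMatrix_mulVec_apply, SimpleGraph.cycleGraph_degree_three_le,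
    SimpleGraph.cycleGraph_neighborFinset] at h'
  have h0 := h' 0
  have h1 := h' 1
  have h2 := h' 2
  have h3 := h' 3
  have h4 := h' 4
  rw [Finset.sum_pair (by decide)] at h0 h1 h2 h3 h4
  norm_num [show (0 : Fin 5) - 1 = 4 from rfl, show (1 : Fin 5) + 1 = 2 from rfl,
    show (2 : Fin 5) - 1 = 1 from rfl, show (2 : Fin 5) + 1 = 3 from rfl,
    show (3 : Fin 5) - 1 = 2 from rfl, show (3 : Fin 5) + 1 = 4 from rfl,
    show (4 : Fin 5) - 1 = 3 from rfl, show (4 : Fin 5) + 1 = 0 from rfl] at h0 h1 h2 h3 h4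
  ext i
  fin_cases i <;> simp <;> linarith

/-! ### The first three moments -/

theorem sum_map_one_add_pow_two (s : Multiset ℝ) :
    (s.map fun x => (1 + x) ^ 2).sum
      = Multiset.card s + 2 * s.sum + (s.map (· ^ 2)).sum := by
  induction s using Multiset.induction with
  | empty => simp
  | cons a s ih =>
    simp only [Multiset.map_cons, Multiset.sum_cons, ih, Multiset.card_cons]
    push_cast
    ring

theorem sum_map_one_add_pow_three (s : Multiset ℝ) :
    (s.map fun x => (1 + x) ^ 3).sum
      = Multiset.card s + 3 * s.sum + 3 * (s.map (· ^ 2)).sum + (s.map (· ^ 3)).sum := by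
  induction s using Multiset.induction with
  | empty => simp
  | cons a s ih =>
    simp only [Multiset.map_cons, Multiset.sum_cons, ih, Multiset.card_cons]
    push_cast
    ring

theorem sum_map_one_add (s : Multiset ℝ) :
    (s.map fun x => 1 + x).sum = Multiset.card s + s.sum := by
  rw [Multiset.sum_map_add]; simp

-- The third relation is only an inequality because the nonnegative triangle term of U is dropped;
-- the triangle term of F is kept.
open Classical in
theorem moments_of_lapSpec_add_one {V T : Type*} [Fintype V] [Fintype T]
    {U : SimpleGraph V} {F : SimpleGraph T} (hU : ∑ v, U.degree v = 2 * Fintype.card V)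
    (hc : Fintype.card T + 1 = Fintype.card V)
    (h : lapSpec U + {1} = (lapSpec F).map (fun x => 1 + x) + {0, (Fintype.card V : ℝ) - 2}) :
    ∑ v, F.degree v = 4 ∧
    (∑ v, (U.degree v : ℝ) ^ 2
      = ((Fintype.card V : ℝ) - 2) ^ 2 + 10 + ∑ v, (F.degree v : ℝ) ^ 2 - Fintype.card V) ∧
    (((Fintype.card V : ℝ) - 2) ^ 3 - 3 * ((Fintype.card V : ℝ) - 2) ^ 2 - 8
      + 4 * Fintype.card V + 3 * ∑ v, (F.degree v : ℝ) ^ 2 + ∑ v, (F.degree v : ℝ) ^ 3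
      - (F.adjMatrix ℝ ^ 3).trace ≤ ∑ v, (U.degree v : ℝ) ^ 3) := by
  obtain ⟨n, hn⟩ : ∃ n : ℝ, n = (Fintype.card V : ℝ) := ⟨_, rfl⟩
  have hT : (Fintype.card T : ℝ) = n - 1 := by rw [hn, ← hc]; push_cast; ring
  have hUr : ∑ v, (U.degree v : ℝ) = 2 * n := by rw [hn]; exact_mod_cast hU
  rw [← hn] at h ⊢
  have k1 := congrArg Multiset.sum h
  rw [Multiset.sum_add, Multiset.sum_add, sum_map_one_add, card_lapSpec, sum_lapSpec, sum_lapSpec,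
    hUr, hT] at k1
  simp only [Multiset.sum_singleton, Multiset.insert_eq_cons, Multiset.sum_cons] at k1
  have hF : ∑ v, (F.degree v : ℝ) = 4 := by linarith
  have k2 := congrArg (fun s => (Multiset.map (· ^ 2) s).sum) h
  simp only [Multiset.map_add, Multiset.sum_add, Multiset.map_map, Function.comp_def,
    sum_map_one_add_pow_two, sum_sq_lapSpec, sum_lapSpec, card_lapSpec, hF, hT,
    Finset.sum_add_distrib, hUr] at k2
  simp only [Multiset.map_singleton, Multiset.sum_singleton, Multiset.insert_eq_cons,
    Multiset.map_cons, Multiset.sum_cons] at k2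
  have k3 := congrArg (fun s => (Multiset.map (· ^ 3) s).sum) h
  simp only [Multiset.map_add, Multiset.sum_add, Multiset.map_map, Function.comp_def,
    sum_map_one_add_pow_three, sum_sq_lapSpec, sum_pow_lapSpec _ 3, trace_lapMatrix_cube,
    sum_lapSpec, card_lapSpec, hF, hT, Finset.sum_add_distrib, ← Finset.mul_sum] at k3
  simp only [Multiset.map_singleton, Multiset.sum_singleton, Multiset.insert_eq_cons,
    Multiset.map_cons, Multiset.sum_cons] at k3
  have k4 := trace_adjMatrix_cube_nonneg U
  refine ⟨by exact_mod_cast hF, by linarith, by linarith⟩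

/-! ### A cospectral mate has an isolated vertex -/

open Classical in
theorem not_lapSpec_eq_of_forall_exists_adj {V W : Type*} [Fintype V] [Fintype W]
    {U : SimpleGraph V} {Q : SimpleGraph W} {m : ℕ} (hm : 1 ≤ m) (hU : IsUnicyclic U)
    (h6 : ¬ Nonempty (U ≃g SimpleGraph.cycleGraph 6))
    (hQ : lapSpec Q = lapSpec Uᶜ + Multiset.replicate m 0)
    (hiso : ∀ w, ∃ w', Q.Adj w w') : False := by
  have hn3 := hU.three_le_card
  have : Nonempty V := Fintype.card_pos_iff.1 (by omega)
  obtain ⟨rfl, s, hs, hcs, hcs2, htop⟩ := exists_split_of_lapSpec_eq hm hU.sum_degree hQ hiso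
  have : Nonempty s := Fintype.card_pos_iff.1 (by omega)
  obtain ⟨F, hF⟩ : ∃ F, F = (Q.induce s)ᶜ := ⟨_, rfl⟩
  have hspec : lapSpec U + {1}
      = (lapSpec F).map (fun x => 1 + x) + {0, (Fintype.card V : ℝ) - 2} := by
    refine lapSpec_add_one_of_compl hcs ?_
    rw [hF, compl_compl, ← lapSpec_top_of_card_eq_two hcs2, ← htop,
      ← lapSpec_eq_induce_add Q s hs, hQ]
    rfl
  obtain ⟨hF4, hU2, hU3⟩ := moments_of_lapSpec_add_one hU.sum_degree hcs hspec
  obtain ⟨hedge, hcases⟩ := degree_facts_of_sum_eq_four hF4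
  rw [trace_adjMatrix_cube_eq_zero hedge] at hU3
  -- Every vertex of `s` has a Q-neighbour in `s`, so F-degrees are at most |s| - 2; for |s| ≤ 3
  -- they cannot sum to 4.
  have hn5 : 5 ≤ Fintype.card V := by
    have hlt : ∀ a, F.degree a + 2 ≤ Fintype.card s := by
      intro a
      obtain ⟨b, hab⟩ := hiso a
      have hb : b ∈ s := by
        by_contra hb
        exact hs a a.2 b hb hab
      have h1 : (⟨b, hb⟩ : s) ∉ insert a (F.neighborFinset a) := by
        rw [Finset.mem_insert, SimpleGraph.mem_neighborFinset, hF, SimpleGraph.compl_adj]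
        rintro (h | h)
        · exact hab.ne (congrArg Subtype.val h).symm
        · exact h.2 hab
      have h2 : (insert a (F.neighborFinset a)).card < Fintype.card s :=
        Finset.card_lt_univ_of_notMem h1
      rw [Finset.card_insert_of_notMem (by simp), SimpleGraph.card_neighborFinset_eq_degree] at h2
      omega
    by_contra! hlt5
    have h3 := Finset.sum_le_card_nsmul Finset.univ (fun a => F.degree a) (Fintype.card s - 2)
      fun a _ => by have := hlt a; omega
    rw [hF4, Finset.card_univ, smul_eq_mul] at h3
    have h4 : Fintype.card s ≤ 3 := by omega
    interval_cases Fintype.card s <;> omega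
  have hconn := hU.1
  have : Nontrivial V := Fintype.one_lt_card_iff_nontrivial.1 (by omega)
  -- Passing to e = deg - 1 and p = n - 4 brings the moments to the form of `power_sum_facts`, where
  -- s = 0 means disjoint edges in F and s = 1 a shared vertex.
  obtain ⟨e, he⟩ : ∃ e : V → ℕ, ∀ v, U.degree v = e v + 1 := by
    refine ⟨fun v => U.degree v - 1, fun v => ?_⟩
    have := hconn.preconnected.degree_pos_of_nontrivial v
    dsimp only
    omega
  obtain ⟨p, hp⟩ : ∃ p : ℕ, Fintype.card V = p + 4 := ⟨Fintype.card V - 4, by omega⟩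
  have he1 : ∑ v, (e v : ℝ) = p + 4 := by
    have h1 := hU.sum_degree
    simp only [he, Finset.sum_add_distrib, hp, Finset.sum_const, Finset.card_univ, smul_eq_mul,
      mul_one] at h1
    have : ∑ v, e v = p + 4 := by omega
    exact_mod_cast this
  have hpr : (Fintype.card V : ℝ) = p + 4 := by rw [hp]; push_cast; rfl
  have he2 : ∑ v, (e v : ℝ) ^ 2 = (p : ℝ) ^ 2 - 2 + ∑ v, (F.degree v : ℝ) ^ 2 := by
    simp only [he, Nat.cast_add, Nat.cast_one, add_sq, Finset.sum_add_distrib, mul_one, one_pow,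
      ← Finset.mul_sum, he1, Finset.sum_const, Finset.card_univ, nsmul_eq_mul, hpr] at hU2
    linarith
  have he3 : (p : ℝ) ^ 3 - 6 + ∑ v, (F.degree v : ℝ) ^ 3 ≤ ∑ v, (e v : ℝ) ^ 3 := by
    have hexp : ∀ v, (U.degree v : ℝ) ^ 3 = (e v : ℝ) ^ 3 + 3 * (e v : ℝ) ^ 2 + 3 * e v + 1 := by
      intro v
      rw [he]; push_cast; ring
    simp only [hexp, Finset.sum_add_distrib, ← Finset.mul_sum, he1, he2, Finset.sum_const,
      Finset.card_univ, nsmul_eq_mul, hpr] at hU3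
    nlinarith
  have hp1 : (1 : ℤ) ≤ p := by omega
  rcases hcases with ⟨hf2, hf3⟩ | ⟨hf2, hf3⟩
  · have hf2' : ∑ v, (F.degree v : ℝ) ^ 2 = 4 := by exact_mod_cast hf2
    have hf3' : ∑ v, (F.degree v : ℝ) ^ 3 = 4 := by exact_mod_cast hf3
    rw [hf2'] at he2
    rw [hf3'] at he3
    obtain ⟨hp2, hle⟩ := (power_sum_facts (e := e) (s := 0) hp1 (by exact_mod_cast he1)
      (by have : ∑ v, (e v : ℝ) ^ 2 = (p : ℝ) ^ 2 + 2 + 2 * 0 := by linarith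
          exact_mod_cast this)
      (by have : (p : ℝ) ^ 3 - 2 + 6 * 0 ≤ ∑ v, (e v : ℝ) ^ 3 := by linarith
          exact_mod_cast this)).1 rfl
    have hp6 : Fintype.card V = 6 := by omega
    apply h6
    rw [← hp6]
    exact hU.nonempty_iso_cycleGraph fun v => by have := hle v; have := he v; omega
  · have hf2' : ∑ v, (F.degree v : ℝ) ^ 2 = 6 := by exact_mod_cast hf2
    have hf3' : ∑ v, (F.degree v : ℝ) ^ 3 = 10 := by exact_mod_cast hf3
    rw [hf2'] at he2
    rw [hf3'] at he3
    obtain ⟨⟨v, hv⟩, hle⟩ := (power_sum_facts (e := e) (s := 1) hp1 (by exact_mod_cast he1)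
      (by have : ∑ v, (e v : ℝ) ^ 2 = (p : ℝ) ^ 2 + 2 + 2 * 1 := by linarith
          exact_mod_cast this)
      (by have : (p : ℝ) ^ 3 - 2 + 6 * 1 ≤ ∑ v, (e v : ℝ) ^ 3 := by linarith
          exact_mod_cast this)).2 rfl
    have hv' : e v = p := by exact_mod_cast hv
    rcases eq_or_ne p 1 with rfl | hp1'
    · obtain ⟨f⟩ := hU.nonempty_iso_cycleGraph fun v => by have := hle v; have := he v; omega
      rw [hp] at f
      have h3 : (3 : ℝ) ∈ lapSpec U + {1} := by
        rw [hspec, hpr]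
        norm_num
      have h3' : (3 : ℝ) ∈ lapSpec (SimpleGraph.cycleGraph 5) := by
        rw [← lapSpec_iso f]
        simpa using h3
      obtain ⟨x, hx, hLx⟩ := exists_eigenvector h3'
      refine hx (eq_zero_of_lapMatrix_cycleGraph_five_mulVec x ?_)
      rw [← hLx]
      congr!
    -- Here deg v + 1 = p + 2 = n - 2, so μ > n - 2 ≥ 4. The prescribed eigenvalues are 0, 1, n - 2
    -- and shifts 1 + φ with φ ≤ 3, none of which is so large.
    · obtain ⟨μ, hμ, hlt⟩ := exists_lt_mem_lapSpec hconn v (by rw [he, hv', hp]; omega)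
      have hp2 : (2 : ℝ) ≤ p := by exact_mod_cast (by omega : 2 ≤ p)
      rw [he, hv'] at hlt
      push_cast at hlt
      have hμ' : μ ∈ lapSpec U + {1} := Multiset.mem_add.2 (Or.inl hμ)
      rw [hspec, Multiset.mem_add, hpr] at hμ'
      rcases hμ' with hμ' | hμ'
      · obtain ⟨φ, hφ, rfl⟩ := Multiset.mem_map.1 hμ'
        have := le_of_mem_lapSpec (c := 3) (by norm_num)
          (fun u v huv => by exact_mod_cast hedge u v huv) hφ
        linarith
      · simp only [Multiset.insert_eq_cons, Multiset.mem_cons, Multiset.mem_singleton] at hμ'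
        rcases hμ' with h | h <;> linarith

/-! ### Induction on the number of isolated vertices -/

/-- Isomorphic graphs have isomorphic complements. -/
def isoCompl {V W : Type*} {G : SimpleGraph V} {H : SimpleGraph W} (e : G ≃g H) : Gᶜ ≃g Hᶜ where
  toEquiv := e.toEquiv
  map_rel_iff' := by
    intro a b
    have h : H.Adj (e.toEquiv a) (e.toEquiv b) ↔ G.Adj a b := e.map_rel_iff
    simp only [SimpleGraph.compl_adj, h, ne_eq, EmbeddingLike.apply_eq_iff_eq]

/-- An equivalence of vertex types is an isomorphism of edgeless graphs. -/
def isoBot {V W : Type*} (e : V ≃ W) : (⊥ : SimpleGraph V) ≃g (⊥ : SimpleGraph W) where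
  toEquiv := e
  map_rel_iff' := by simp

theorem sum_bot_bot (V W : Type*) :
    (⊥ : SimpleGraph V).sum (⊥ : SimpleGraph W) = ⊥ := by
  ext (a | a) (b | b) <;> simp

theorem lapSpec_eq_of_compl {V W : Type*} [Fintype V] [Fintype W] {G : SimpleGraph V}
    {H : SimpleGraph W} (h : lapSpec G = lapSpec H) : lapSpec Gᶜ = lapSpec Hᶜ := by
  have hc : Fintype.card V = Fintype.card W := by rw [← card_lapSpec G, h, card_lapSpec]
  rcases isEmpty_or_nonempty V with hV | hV
  · have e1 : lapSpec Gᶜ = 0 := Multiset.card_eq_zero.1 (by rw [card_lapSpec, Fintype.card_eq_zero])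
    have e2 : lapSpec Hᶜ = 0 := Multiset.card_eq_zero.1 (by
      rw [card_lapSpec, ← hc, Fintype.card_eq_zero])
    rw [e1, e2]
  · have hW : Nonempty W := Fintype.card_pos_iff.1 (hc ▸ Fintype.card_pos)
    have h1 := lapSpec_compl G
    have h2 := lapSpec_compl H
    rw [h, hc, ← h2] at h1
    exact (Multiset.cons_inj_right _).1 h1

open Classical in
theorem nonempty_iso_sum_bot.{u} {V : Type u} [Fintype V] {U : SimpleGraph V}
    (hU : IsUnicyclic U) (hLDS : IsLDS U) (h6 : ¬ Nonempty (U ≃g SimpleGraph.cycleGraph 6))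
    (m : ℕ) : ∀ (W : Type u) [Fintype W] (Q : SimpleGraph W),
      lapSpec Q = lapSpec Uᶜ + Multiset.replicate m 0 →
        Nonempty (Q ≃g Uᶜ.sum (⊥ : SimpleGraph (Fin m))) := by
  induction m with
  | zero =>
    intro W _ Q hQ
    rw [Multiset.replicate_zero, add_zero] at hQ
    have h1 := lapSpec_eq_of_compl hQ
    rw [compl_compl] at h1
    obtain ⟨e⟩ := hLDS W Qᶜ h1
    have e' := isoCompl e
    rw [compl_compl] at e'
    refine ⟨e'.trans ?_⟩
    exact
      { toEquiv := (Equiv.sumEmpty V (Fin 0)).symm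
        map_rel_iff' := by simp }
  | succ m ih =>
    intro W _ Q hQ
    by_cases hiso : ∀ w, ∃ w', Q.Adj w w'
    -- If no vertex is isolated the contradiction applies; otherwise deleting an isolated vertex
    -- removes one 0 from the spectrum.
    · exact (not_lapSpec_eq_of_forall_exists_adj (Nat.le_add_left 1 m) hU h6 hQ hiso).elim
    push Not at hiso
    obtain ⟨w, hw⟩ := hiso
    have hs : ∀ a ∈ ({w} : Set W), ∀ b ∉ ({w} : Set W), ¬ Q.Adj a b := by
      rintro a rfl b -
      exact hw b
    have hbot : Q.induce {w} = ⊥ := by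
      ext ⟨a, rfl⟩ ⟨b, rfl⟩
      simp
    have h1 := lapSpec_eq_induce_add Q {w} hs
    rw [hbot, lapSpec_bot, hQ, Multiset.replicate_succ] at h1
    have h2 : lapSpec (Q.induce {w}ᶜ) = lapSpec Uᶜ + Multiset.replicate m 0 := by
      have h3 : ∀ _ : Fintype ({w} : Set W), Fintype.card ({w} : Set W) = 1 := fun _ =>
        Fintype.card_eq_one_iff.2 ⟨⟨w, rfl⟩, fun a => Subtype.ext a.2⟩
      rw [h3, Multiset.replicate_one, ← Multiset.singleton_add, add_left_comm] at h1
      exact (add_left_cancel h1).symm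
    obtain ⟨e⟩ := ih _ _ h2
    have e1 := (sumInduceIso Q {w} hs).symm
    rw [hbot] at e1
    refine ⟨e1.trans (SimpleGraph.Iso.sumComm.trans ((SimpleGraph.Iso.sumCongr e
      (isoBot (Equiv.equivPUnit.{_, 1} ({w} : Set W)))).trans
        (SimpleGraph.Iso.sumAssoc.trans (SimpleGraph.Iso.sumCongr SimpleGraph.Iso.refl ?_))))⟩
    rw [sum_bot_bot]
    exact isoBot (Fintype.equivFinOfCardEq (by simp))

theorem compl_join {V W : Type*} (G : SimpleGraph V) (H : SimpleGraph W) :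
    (join G H)ᶜ = Gᶜ.sum Hᶜ := by
  ext (a | a) (b | b) <;> simp +contextual [join]

theorem isLDS_join.{u} {V : Type u} [Fintype V] {U : SimpleGraph V}
    (hU : IsUnicyclic U) (hLDS : IsLDS U) (h6 : ¬ Nonempty (U ≃g SimpleGraph.cycleGraph 6))
    (m : ℕ) : IsLDS (join U (K m)) := by
  intro W _ H hH
  have h1 := lapSpec_eq_of_compl hH
  have hK : (K m)ᶜ = ⊥ := compl_top
  rw [compl_join, lapSpec_sum, hK, lapSpec_bot, Fintype.card_fin] at h1
  obtain ⟨e⟩ := nonempty_iso_sum_bot hU hLDS h6 m W Hᶜ h1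
  rw [← hK, ← compl_join] at e
  have e' := isoCompl e
  rw [compl_compl, compl_compl] at e'
  exact ⟨e'⟩

/-! ### The exceptional graph C_6 -/

theorem charpoly_eq_of_mul_eq {n : Type*} [Fintype n] [DecidableEq n] {A B P : Matrix n n ℝ}
    (hP : P.det ≠ 0) (h : A * P = P * B) : A.charpoly = B.charpoly := by
  refine Polynomial.funext fun x => mul_right_cancel₀ hP ?_
  rw [eval_charpoly, eval_charpoly, mul_comm (scalar n x - B).det, ← det_mul, ← det_mul,
    sub_mul, mul_sub, h, (scalar_commute x (fun _ => mul_comm _ _) P).eq]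

theorem lapMatrix_map_intCast {V : Type*} [Fintype V] [DecidableEq V] (G : SimpleGraph V)
    [DecidableRel G.Adj] : (G.lapMatrix ℤ).map (Int.castRingHom ℝ) = G.lapMatrix ℝ := by
  ext i j
  by_cases h : i = j <;> by_cases h' : G.Adj i j <;>
    simp [SimpleGraph.lapMatrix, SimpleGraph.degMatrix, h, h']

/-- Eigenvectors of the Laplacian matrix of the hexagon, as columns. -/
def hexagonEigenvectors : Matrix (Fin 6) (Fin 6) ℤ :=
  !![1, 2, 0, 2, 0, 1;
     1, 1, 1, -1, 1, -1;
     1, -1, 1, -1, -1, 1;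
     1, -2, 0, 2, 0, -1;
     1, -1, -1, -1, 1, 1;
     1, 1, -1, -1, -1, -1]

theorem lapSpec_cycleGraph_six : lapSpec (SimpleGraph.cycleGraph 6) = {0, 1, 1, 3, 3, 4} := by
  have h1 : (SimpleGraph.cycleGraph 6).lapMatrix ℤ * hexagonEigenvectors
      = hexagonEigenvectors * diagonal ![0, 1, 1, 3, 3, 4] := by
    decide +kernel
  -- Orthogonality of the columns gives the square of the determinant as a product of nonzero norms,
  -- so the determinant itself need not be expanded.
  have h2 : hexagonEigenvectorsᵀ * hexagonEigenvectors = diagonal ![6, 12, 4, 12, 4, 6] := by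
    decide +kernel
  have h3 : hexagonEigenvectors.det ≠ 0 := by
    intro h
    have := congrArg det h2
    rw [det_mul, h, mul_zero, det_diagonal] at this
    simp [Fin.prod_univ_succ] at this
  rw [lapSpec_eq, ← lapMatrix_map_intCast, charpoly_eq_of_mul_eq (P := hexagonEigenvectors.map
    (Int.castRingHom ℝ)) (B := (diagonal ![0, 1, 1, 3, 3, 4]).map (Int.castRingHom ℝ)),
    charpoly_map, charpoly_diagonal]
  · have := roots_multiset_prod_X_sub_C ({0, 1, 1, 3, 3, 4} : Multiset ℝ)
    rw [← this]
    congr 1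
    simp [Fin.prod_univ_succ]
    exact Or.inl (by simp only [map_ofNat])
  · rw [← RingHom.mapMatrix_apply, ← RingHom.map_det]
    simpa using h3
  · rw [← Matrix.map_mul, ← Matrix.map_mul, h1]

theorem lCospectral_wheel_six : LCospectral (join (SimpleGraph.cycleGraph 6) (K 1))
    (join ((K 1).sum (K 1)) (((SimpleGraph.pathGraph 2).sum (SimpleGraph.pathGraph 2)).sum (K 1))) := by
  have hK : K 1 = ⊥ := by ext a b; simp [K, Subsingleton.elim a b]
  have hK' : lapSpec (⊥ : SimpleGraph (Fin 1)) = {0} := by rw [lapSpec_bot]; rfl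
  have hP : lapSpec (SimpleGraph.pathGraph 2) = {0, 2} := by
    rw [SimpleGraph.pathGraph_two_eq_top]
    exact lapSpec_top_of_card_eq_two (by simp)
  have hC : lapSpec (SimpleGraph.cycleGraph 6)ᶜ = {0, 2, 3, 3, 5, 5} := by
    have h := lapSpec_compl (SimpleGraph.cycleGraph 6)
    rw [lapSpec_cycleGraph_six] at h
    refine (Multiset.cons_inj_right (6 : ℝ)).1 ?_
    norm_num [Multiset.insert_eq_cons] at h
    rw [h]
    simp only [Multiset.insert_eq_cons, ← Multiset.singleton_add]
    abel
  have hM : lapSpec (((SimpleGraph.pathGraph 2).sum (SimpleGraph.pathGraph 2)).sum (K 1))ᶜ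
      = {0, 3, 3, 5, 5} := by
    have h := lapSpec_compl
      (((SimpleGraph.pathGraph 2).sum (SimpleGraph.pathGraph 2)).sum (K 1))
    rw [lapSpec_sum, lapSpec_sum, hP, hK, hK'] at h
    rw [hK]
    refine (Multiset.cons_inj_right (5 : ℝ)).1 ?_
    norm_num [Multiset.insert_eq_cons] at h
    rw [h]
    simp only [Multiset.insert_eq_cons, ← Multiset.singleton_add]
    abel
  have hT : lapSpec ((K 1).sum (K 1))ᶜ = {0, 2} := by
    rw [hK, sum_bot_bot, compl_bot]
    exact lapSpec_top_of_card_eq_two (by simp)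
  have hK'' : lapSpec (K 1)ᶜ = {0} := by
    rw [K, compl_top, hK']
  have key := lapSpec_eq_of_compl (G := (join (SimpleGraph.cycleGraph 6) (K 1))ᶜ)
    (H := (join ((K 1).sum (K 1))
      (((SimpleGraph.pathGraph 2).sum (SimpleGraph.pathGraph 2)).sum (K 1)))ᶜ) (by
    rw [compl_join, compl_join, lapSpec_sum, lapSpec_sum, hC, hM, hT, hK'']
    simp only [Multiset.insert_eq_cons, ← Multiset.singleton_add]
    abel)
  rwa [compl_compl, compl_compl] at key

/-- The hub of the wheel is adjacent to every other vertex, and the second graph has no such vertex.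
-/
theorem not_nonempty_iso_wheel_six : ¬ Nonempty (join (SimpleGraph.cycleGraph 6) (K 1) ≃g
    join ((K 1).sum (K 1))
      (((SimpleGraph.pathGraph 2).sum (SimpleGraph.pathGraph 2)).sum (K 1))) := by
  rintro ⟨e⟩
  have huniv : ∀ y, y ≠ e (Sum.inr 0) → (join ((K 1).sum (K 1))
      (((SimpleGraph.pathGraph 2).sum (SimpleGraph.pathGraph 2)).sum (K 1))).Adj
        (e (Sum.inr 0)) y := by
    intro y hy
    obtain ⟨x, rfl⟩ := e.surjective y
    rw [SimpleGraph.Iso.map_adj_iff]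
    have hx : x ≠ Sum.inr 0 := fun h => hy (by rw [h])
    rcases x with x | x
    · simp [join]
    · exact absurd (congrArg Sum.inr (Subsingleton.elim x 0)) hx
  generalize e (Sum.inr 0) = z at huniv
  rcases z with (z | z) | ((z | z) | z)
  · simpa [join] using huniv (Sum.inl (Sum.inr 0))
  · simpa [join] using huniv (Sum.inl (Sum.inl 0))
  · simpa [join] using huniv (Sum.inr (Sum.inr 0))
  · simpa [join] using huniv (Sum.inr (Sum.inr 0))
  · simpa [join] using huniv (Sum.inr (Sum.inl (Sum.inl 0)))

end LapDS

theorem theorem9 :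
    (∀ (V : Type*) [Fintype V] (U : SimpleGraph V),
      LapDS.IsUnicyclic U → LapDS.IsLDS U → ¬ Nonempty (U ≃g SimpleGraph.cycleGraph 6) →
        ∀ m : ℕ, 1 ≤ m → LapDS.IsLDS (LapDS.join U (LapDS.K m))) ∧
    LapDS.LCospectral
      (LapDS.join (SimpleGraph.cycleGraph 6) (LapDS.K 1))
      (LapDS.join (SimpleGraph.sum (LapDS.K 1) (LapDS.K 1))
        (SimpleGraph.sum (SimpleGraph.sum (SimpleGraph.pathGraph 2) (SimpleGraph.pathGraph 2))
          (LapDS.K 1))) ∧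
    ¬ Nonempty
      (LapDS.join (SimpleGraph.cycleGraph 6) (LapDS.K 1) ≃g
        LapDS.join (SimpleGraph.sum (LapDS.K 1) (LapDS.K 1))
          (SimpleGraph.sum (SimpleGraph.sum (SimpleGraph.pathGraph 2) (SimpleGraph.pathGraph 2))
            (LapDS.K 1))) :=
  ⟨fun _ _ _ hU hLDS h6 m _ => LapDS.isLDS_join hU hLDS h6 m, LapDS.lCospectral_wheel_six,
    LapDS.not_nonempty_iso_wheel_six⟩
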